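/- Let $n>2$ be an integer and let $M_n=F_n/F_n''$ be the free metabelian group of rank $n$, i.e. the quotient of the free group $F_n$ of rank $n$ by its second derived subgroup, with canonical generators $a_1,\dots,a_n$ and derived subgroup $M_n'=[M_n,M_n]$. A bi-order on a group $G$ is a total order $\leqslant$ on $G$ such that $g\leqslant h$ implies $f_1gf_2\leqslant f_1hf_2$ for all $f_1,f_2\in G$. A subset $S\subseteq G$ is convex with respect to $\leqslant$ if $h\in S$ whenever $f\leqslant h\leqslant g$ with $f,g\in S$, and the convex hull of a subgroup $H$ is the smallest convex subgroup of $G$ containing $H$. Let $t_1,\dots,t_n\in\mathbb Z$ be such that $a_1^{t_1}a_2^{t_2}\cdots a_n^{t_n}$ is a non-trivial element of $M_n$. Then there exists a bi-order on $M_n$ with respect to which the convex hull of $M_n'$ contains $a_1^{t_1}a_2^{t_2}\cdots a_n^{t_n}$. In particular, for every $n>2$ there exists a bi-order on $M_n$ with respect to which $M_n'$ is not convex. -/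

import Mathlib

/-- The free metabelian group of rank `n`: the quotient of the free group of rank `n` by its second
derived subgroup. -/
abbrev FreeMetabelianGroup (n : ℕ) : Type :=
  FreeGroup (Fin n) ⧸ derivedSeries (FreeGroup (Fin n)) 2

namespace FreeMetabelianGroup

/-- The canonical generators. -/
def gen {n : ℕ} (i : Fin n) : FreeMetabelianGroup n :=
  QuotientGroup.mk (FreeGroup.of i)

/-- The element `a₁ ^ t₁ * a₂ ^ t₂ * ⋯ * aₙ ^ tₙ`, multiplied in this order. -/
def monomial {n : ℕ} (t : Fin n → ℤ) : FreeMetabelianGroup n :=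
  (List.ofFn fun i => gen i ^ t i).prod

end FreeMetabelianGroup

/-- A linear order on a group is a bi-order if it is invariant under multiplication from both
sides. -/
def IsBiOrder {G : Type*} [Group G] (o : LinearOrder G) : Prop :=
  ∀ g h : G, o.le g h → ∀ f₁ f₂ : G, o.le (f₁ * g * f₂) (f₁ * h * f₂)

/-- A subset `S` is convex for the order `o` if for all `f ≤ g` in `S` every `h` with
`f ≤ h ≤ g` belongs to `S`. -/
def IsOrderConvex {G : Type*} (o : LinearOrder G) (S : Set G) : Prop :=
  @Set.OrdConnected G o.toPreorder S

/-- The convex hull of a subgroup `H`: the smallest convex subgroup containing `H`. -/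
def orderConvexHull {G : Type*} [Group G] (o : LinearOrder G) (H : Subgroup G) : Subgroup G :=
  sInf {K : Subgroup G | H ≤ K ∧ IsOrderConvex o (K : Set G)}

theorem isLeast_orderConvexHull {G : Type*} [Group G] (o : LinearOrder G) (H : Subgroup G) :
    IsLeast {K : Subgroup G | H ≤ K ∧ IsOrderConvex o (K : Set G)} (orderConvexHull o H) := by
  refine ⟨⟨le_sInf fun K hK => hK.1, ?_⟩, fun K hK => sInf_le hK⟩
  refine @Set.OrdConnected.mk G o.toPreorder _ ?_
  intro f hf g hg h hh
  have hf' := Subgroup.mem_sInf.1 hf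
  have hg' := Subgroup.mem_sInf.1 hg
  exact Subgroup.mem_sInf.2 fun K hK => hK.2.out' (hf' K hK) (hg' K hK) hh

/-! A bi-order can be built lexicographically along a homomorphism `f` from the free metabelian
group `M`: compare images under `f` first, and break ties on `ker f` by a conjugation-invariant
order. If `f` kills the monomial but not some commutator `c`, then `c` or its inverse has positive
image, so the monomial lies between `c⁻¹` and `c`, hence in the convex hull of `M'`. It remains
outside `M'` when `t ≠ 0`, so `M'` is not convex.

Two ingredients are needed. `exists_hom_ratHeisenberg` supplies `f`, with values in the rational
Heisenberg group; having three generators leaves room for it. `exists_isConeOn` supplies a bi-order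
of `M` itself, which is restricted to `ker f`; it comes from the Magnus embedding of `M` into a
semidirect product of one-chains by a free abelian group. -/

/-- `P` is the set of positive elements of a total order on the subgroup `K` which is invariant
under multiplication by `K` and conjugation by the whole group. -/
structure IsConeOn {G : Type*} [Group G] (K : Subgroup G) (P : Set G) : Prop where
  one_notMem : 1 ∉ P
  mul_mem : ∀ g ∈ K, ∀ h ∈ K, g ∈ P → h ∈ P → g * h ∈ P
  conj_mem : ∀ g ∈ K, g ∈ P → ∀ f, f * g * f⁻¹ ∈ P
  total : ∀ g ∈ K, g = 1 ∨ g ∈ P ∨ g⁻¹ ∈ P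

/-! ### Positive cones and bi-orders -/

namespace IsConeOn

variable {G H : Type*} [Group G] [Group H]

theorem mono {K L : Subgroup G} {P : Set G} (hP : IsConeOn L P) (h : K ≤ L) : IsConeOn K P where
  one_notMem := hP.one_notMem
  mul_mem g hg k hk := hP.mul_mem g (h hg) k (h hk)
  conj_mem g hg := hP.conj_mem g (h hg)
  total g hg := hP.total g (h hg)

theorem comap {P : Set H} (hP : IsConeOn ⊤ P) (f : G →* H) (hf : Function.Injective f) :
    IsConeOn ⊤ (f ⁻¹' P) where
  one_notMem := by simpa using hP.one_notMem
  mul_mem g _ h _ hg hh := by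
    simpa using hP.mul_mem (f g) trivial (f h) trivial hg hh
  conj_mem g _ hg k := by simpa using hP.conj_mem (f g) trivial hg (f k)
  total g _ := by
    simpa [map_eq_one_iff f hf] using hP.total (f g) trivial

/-- The lexicographic cone of an extension. -/
theorem lex {PH : Set H} {PN : Set G} (hH : IsConeOn ⊤ PH) (f : G →* H)
    (hN : IsConeOn f.ker PN) : IsConeOn ⊤ {g | f g ∈ PH ∨ f g = 1 ∧ g ∈ PN} where
  one_notMem := by simp [hH.one_notMem, hN.one_notMem]
  mul_mem g _ h _ hg hh := by
    rcases hg with hg | ⟨hg, hg'⟩ <;> rcases hh with hh | ⟨hh, hh'⟩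
    · exact Or.inl (by simpa using hH.mul_mem _ trivial _ trivial hg hh)
    · exact Or.inl (by simpa [hh] using hg)
    · exact Or.inl (by simpa [hg] using hh)
    · exact Or.inr ⟨by simp [hg, hh], hN.mul_mem _ hg _ hh hg' hh'⟩
  conj_mem g _ hg k := by
    rcases hg with hg | ⟨hg, hg'⟩
    · exact Or.inl (by simpa using hH.conj_mem _ trivial hg (f k))
    · exact Or.inr ⟨by simp [hg], hN.conj_mem _ hg hg' k⟩
  total g _ := by
    rcases hH.total (f g) trivial with h | h | h
    · rcases hN.total g h with h' | h' | h'
      · exact Or.inl h'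
      · exact Or.inr (Or.inl (Or.inr ⟨h, h'⟩))
      · exact Or.inr (Or.inr (Or.inr ⟨by simp [h], h'⟩))
    · exact Or.inr (Or.inl (Or.inl h))
    · exact Or.inr (Or.inr (Or.inl (by simpa using h)))

theorem exists_isBiOrder {P : Set G} (hP : IsConeOn ⊤ P) :
    ∃ o : LinearOrder G, IsBiOrder o ∧ ∀ g h, g⁻¹ * h ∈ P → o.le g h := by
  classical
  refine ⟨{ le := fun g h => g = h ∨ g⁻¹ * h ∈ P
            le_refl := fun g => Or.inl rfl
            le_trans := ?_
            le_antisymm := ?_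
            le_total := ?_
            toDecidableLE := Classical.decRel _ }, ?_, fun g h => Or.inr⟩
  · rintro a b c (rfl | hab) (rfl | hbc)
    · exact Or.inl rfl
    · exact Or.inr hbc
    · exact Or.inr hab
    · exact Or.inr (by simpa [mul_assoc] using hP.mul_mem _ trivial _ trivial hab hbc)
  · rintro a b (rfl | hab) (h | hba)
    · rfl
    · rfl
    · exact h.symm
    · exact absurd (by simpa [mul_assoc] using hP.mul_mem _ trivial _ trivial hab hba)
        hP.one_notMem
  · intro a b
    rcases hP.total (a⁻¹ * b) trivial with h | h | h
    · exact Or.inl (Or.inl (inv_mul_eq_one.1 h))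
    · exact Or.inl (Or.inr h)
    · exact Or.inr (Or.inr (by simpa using h))
  · rintro g h (rfl | hgh) a b
    · exact Or.inl rfl
    -- The left factor cancels in the quotient, and the right factor conjugates it.
    · exact Or.inr (by simpa [mul_assoc] using hP.conj_mem _ trivial hgh b⁻¹)

theorem of_linearOrder (Q : Type*) [CommGroup Q] [LinearOrder Q] [IsOrderedMonoid Q] :
    IsConeOn ⊤ {q : Q | 1 < q} where
  one_notMem := lt_irrefl _
  mul_mem _ _ _ _ := one_lt_mul''
  conj_mem g _ hg f := by simpa [mul_comm f g] using hg
  total g _ := by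
    rcases lt_trichotomy g 1 with h | h | h
    · exact Or.inr (Or.inr (by simpa using h))
    · exact Or.inl h
    · exact Or.inr (Or.inl h)

end IsConeOn

theorem derivedSeries_two_eq_bot {G A : Type*} [Group G] [CommGroup A] (f : G →* A)
    (hf : ∀ g ∈ f.ker, ∀ h ∈ f.ker, g * h = h * g) : derivedSeries G 2 = ⊥ := by
  have h1 : derivedSeries G 1 ≤ f.ker := by
    rw [derivedSeries_one]
    exact Abelianization.commutator_subset_ker f
  rw [eq_bot_iff, derivedSeries_succ]
  refine Subgroup.commutator_le.2 fun g hg h hh => ?_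
  rw [Subgroup.mem_bot, commutatorElement_eq_one_iff_mul_comm]
  exact hf g (h1 hg) h (h1 hh)

theorem derivedSeries_two_le_ker {F G : Type*} [Group F] [Group G] (hG : derivedSeries G 2 = ⊥)
    (f : F →* G) : derivedSeries F 2 ≤ f.ker := by
  have := map_derivedSeries_le_derivedSeries f 2
  rwa [hG, Subgroup.map_le_iff_le_comap] at this

/-! ### The rational Heisenberg group -/

/-- The group of upper unitriangular rational matrices of size three. -/
@[ext]
structure RatHeisenberg where
  x : ℚ
  y : ℚ
  z : ℚ

namespace RatHeisenberg

instance : Mul RatHeisenberg := ⟨fun g h => ⟨g.x + h.x, g.y + h.y, g.z + h.z + g.x * h.y⟩⟩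
instance : One RatHeisenberg := ⟨⟨0, 0, 0⟩⟩
instance : Inv RatHeisenberg := ⟨fun g => ⟨-g.x, -g.y, -g.z + g.x * g.y⟩⟩

@[simp] theorem mul_x (g h : RatHeisenberg) : (g * h).x = g.x + h.x := rfl
@[simp] theorem mul_y (g h : RatHeisenberg) : (g * h).y = g.y + h.y := rfl
@[simp] theorem mul_z (g h : RatHeisenberg) : (g * h).z = g.z + h.z + g.x * h.y := rfl
@[simp] theorem one_x : (1 : RatHeisenberg).x = 0 := rfl
@[simp] theorem one_y : (1 : RatHeisenberg).y = 0 := rfl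
@[simp] theorem one_z : (1 : RatHeisenberg).z = 0 := rfl
@[simp] theorem inv_x (g : RatHeisenberg) : g⁻¹.x = -g.x := rfl
@[simp] theorem inv_y (g : RatHeisenberg) : g⁻¹.y = -g.y := rfl
@[simp] theorem inv_z (g : RatHeisenberg) : g⁻¹.z = -g.z + g.x * g.y := rfl

instance : Group RatHeisenberg :=
  Group.ofLeftAxioms (fun a b c => by ext <;> simp <;> ring) (fun a => by ext <;> simp)
    (fun a => by ext <;> simp)

/-- The first coordinate. -/
def xHom : RatHeisenberg →* Multiplicative ℚ where
  toFun g := Multiplicative.ofAdd g.x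
  map_one' := rfl
  map_mul' _ _ := rfl

/-- The second coordinate. -/
def yHom : RatHeisenberg →* Multiplicative ℚ where
  toFun g := Multiplicative.ofAdd g.y
  map_one' := rfl
  map_mul' _ _ := rfl

theorem derivedSeries_two : derivedSeries RatHeisenberg 2 = ⊥ := by
  refine derivedSeries_two_eq_bot xHom fun g hg h hh => ?_
  have hg : g.x = 0 := hg
  have hh : h.x = 0 := hh
  ext <;> simp [hg, hh, add_comm]

/-- Conjugation fixes `x` and `y`, and also `z` when both vanish, so it preserves the first nonzero
coordinate. -/
theorem isConeOn :
    IsConeOn ⊤ {g : RatHeisenberg | 0 < g.x ∨ g.x = 0 ∧ (0 < g.y ∨ g.y = 0 ∧ 0 < g.z)} where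
  one_notMem := by simp
  mul_mem g _ h _ hg hh := by
    simp only [Set.mem_ofPred_eq, mul_x, mul_y, mul_z] at *
    rcases hg with hg | ⟨hg, hg | ⟨hg', hg''⟩⟩ <;> rcases hh with hh | ⟨hh, hh | ⟨hh', hh''⟩⟩
    all_goals first
      | (left; linarith)
      | (right; refine ⟨by linarith, ?_⟩; left; linarith)
      | (right; refine ⟨by linarith, ?_⟩; right; refine ⟨by linarith, ?_⟩; rw [hg]; linarith)
  conj_mem g _ hg f := by
    simp only [Set.mem_ofPred_eq, mul_x, mul_y, mul_z, inv_x, inv_y, inv_z] at *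
    rcases hg with hg | ⟨hg, hg | ⟨hg', hg''⟩⟩
    · left; linarith
    · right; exact ⟨by linarith, Or.inl (by linarith)⟩
    · right; exact ⟨by linarith, Or.inr ⟨by linarith, by rw [hg, hg']; linarith⟩⟩
  total g _ := by
    simp only [Set.mem_ofPred_eq, inv_x, inv_y, inv_z]
    rcases lt_trichotomy g.x 0 with hx | hx | hx
    · right; right; left; linarith
    · rcases lt_trichotomy g.y 0 with hy | hy | hy
      · right; right; right; exact ⟨by linarith, Or.inl (by linarith)⟩
      · rcases lt_trichotomy g.z 0 with hz | hz | hz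
        · right; right; right
          exact ⟨by linarith, Or.inr ⟨by linarith, by rw [hx]; linarith⟩⟩
        · left; ext <;> assumption
        · right; left; right; exact ⟨hx, Or.inr ⟨hy, hz⟩⟩
      · right; left; right; exact ⟨hx, Or.inl hy⟩
    · right; left; left; exact hx

end RatHeisenberg

/-! ### A Heisenberg quotient killing the monomial -/

namespace FreeMetabelianGroup

variable {n : ℕ}

/-- The homomorphism to a metabelian group with given values on the generators. -/
def lift {G : Type*} [Group G] (hG : derivedSeries G 2 = ⊥) (f : Fin n → G) :
    FreeMetabelianGroup n →* G :=
  QuotientGroup.lift _ (FreeGroup.lift f) (derivedSeries_two_le_ker hG _)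

@[simp]
theorem lift_gen {G : Type*} [Group G] (hG : derivedSeries G 2 = ⊥) (f : Fin n → G) (i : Fin n) :
    lift hG f (gen i) = f i :=
  FreeGroup.lift_apply_of

theorem derivedSeries_two_eq_bot_of_comm (A : Type*) [CommGroup A] : derivedSeries A 2 = ⊥ :=
  derivedSeries_two_eq_bot (MonoidHom.id A) fun _ _ _ _ => mul_comm _ _

theorem map_monomial {A : Type*} [CommGroup A] (f : FreeMetabelianGroup n →* A) (t : Fin n → ℤ) :
    f (monomial t) = ∏ i, f (gen i) ^ t i := by
  rw [monomial, map_list_prod, List.map_ofFn, List.prod_ofFn]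
  simp

theorem monomial_zero : monomial (0 : Fin n → ℤ) = 1 := by
  refine List.prod_eq_one fun x hx => ?_
  obtain ⟨i, rfl⟩ := List.mem_ofFn.1 hx
  simp

theorem monomial_notMem_commutator {t : Fin n → ℤ} (ht : t ≠ 0) :
    monomial t ∉ commutator (FreeMetabelianGroup n) := by
  obtain ⟨j, hj⟩ := Function.ne_iff.1 ht
  intro h
  let f : FreeMetabelianGroup n →* Multiplicative ℤ :=
    lift (derivedSeries_two_eq_bot_of_comm _) (Pi.mulSingle j (Multiplicative.ofAdd 1))
  have hf : f (monomial t) = 1 := Abelianization.commutator_subset_ker f h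
  rw [map_monomial, Finset.prod_eq_single j (fun i _ hij => by simp [f, hij]) (by simp)] at hf
  have := congrArg Multiplicative.toAdd hf
  simp [f] at this
  exact hj this

theorem exists_hom_ratHeisenberg (hn : 2 < n) {t : Fin n → ℤ} (ht : t ≠ 0) :
    ∃ f : FreeMetabelianGroup n →* RatHeisenberg, f (monomial t) = 1 ∧
      ∃ c ∈ commutator (FreeMetabelianGroup n), f c ≠ 1 := by
  obtain ⟨j, hj⟩ := Function.ne_iff.1 ht
  have hj : (t j : ℚ) ≠ 0 := by exact_mod_cast hj
  obtain ⟨i, hi, k, hk, hik⟩ : ∃ i, i ≠ j ∧ ∃ k, k ≠ j ∧ i ≠ k := by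
    have h : 1 < ({j}ᶜ : Finset (Fin n)).card := by
      rw [Finset.card_compl]
      simp
      omega
    obtain ⟨i, hi, k, hk, hik⟩ := Finset.one_lt_card.1 h
    exact ⟨i, by simpa using hi, k, by simpa using hk, hik⟩
  -- Both `a` and `b` are orthogonal to `t`, so the monomial is sent into the centre; the generators
  -- `i` and `k` are sent to the two standard noncommuting ones.
  let a : Fin n → ℚ := Pi.single i 1 + Pi.single j (-(t i : ℚ) / t j)
  let b : Fin n → ℚ := Pi.single k 1 + Pi.single j (-(t k : ℚ) / t j)
  have sum_single (l : Fin n) (hl : l ≠ j) :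
      ∑ m, (t m : ℚ) * (Pi.single l 1 + Pi.single j (-(t l : ℚ) / t j) : Fin n → ℚ) m = 0 := by
    simp only [Pi.add_apply, mul_add, Finset.sum_add_distrib, Pi.single_apply, mul_ite, mul_zero,
      Finset.sum_ite_eq', Finset.mem_univ, if_true]
    field_simp
    simp
  let g : FreeMetabelianGroup n →* RatHeisenberg :=
    lift RatHeisenberg.derivedSeries_two fun m => ⟨a m, b m, 0⟩
  have hgx : (g (monomial t)).x = 0 := by
    have := congrArg Multiplicative.toAdd (map_monomial (RatHeisenberg.xHom.comp g) t)
    rw [toAdd_prod] at this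
    refine this.trans ((Finset.sum_congr rfl fun m _ => ?_).trans (sum_single i hi))
    simp [g, RatHeisenberg.xHom, a, mul_add]
  have hgy : (g (monomial t)).y = 0 := by
    have := congrArg Multiplicative.toAdd (map_monomial (RatHeisenberg.yHom.comp g) t)
    rw [toAdd_prod] at this
    refine this.trans ((Finset.sum_congr rfl fun m _ => ?_).trans (sum_single k hk))
    simp [g, RatHeisenberg.yHom, b, mul_add]
  -- Multiplying `g` by a central character changes no commutator; this one cancels the remaining
  -- `z` of the monomial.
  let e : FreeMetabelianGroup n →* Multiplicative ℚ :=
    lift (derivedSeries_two_eq_bot_of_comm _)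
      (Pi.mulSingle j (Multiplicative.ofAdd (-(g (monomial t)).z / t j)))
  have he : (e (monomial t)).toAdd = -(g (monomial t)).z := by
    rw [map_monomial, Finset.prod_eq_single j (fun i _ hij => by simp [e, hij]) (by simp)]
    simp [e]
    field_simp
  let f : FreeMetabelianGroup n →* RatHeisenberg :=
    { toFun := fun w => ⟨(g w).x, (g w).y, (g w).z + (e w).toAdd⟩
      map_one' := by ext <;> simp
      map_mul' := fun v w => by ext <;> simp; ring }
  refine ⟨f, ?_, gen i * gen k * (gen i)⁻¹ * (gen k)⁻¹,
    Subgroup.commutator_mem_commutator (Subgroup.mem_top _) (Subgroup.mem_top _), ?_⟩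
  · ext
    · exact hgx
    · exact hgy
    · change (g (monomial t)).z + (e (monomial t)).toAdd = 0
      rw [he]
      ring
  · intro h
    have h := congrArg RatHeisenberg.z h
    simp [f, g, e, a, b, hi, hk, hik, hik.symm] at h

end FreeMetabelianGroup

/-! ### The Magnus embedding and its order -/

namespace Magnus

variable {Q X : Type*}

/-- The edges of the Cayley graph of `Q` with respect to generators indexed by `X`. -/
abbrev Edge (Q X : Type*) : Type _ := Q ×ₗ X

section Translation

variable [Group Q]

/-- Left translation of edges. -/
def translate (q : Q) : Edge Q X ≃ Edge Q X :=
  ofLex.trans (((Equiv.mulLeft q).prodCongr (Equiv.refl X)).trans toLex)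

@[simp]
theorem translate_toLex (q r : Q) (x : X) :
    translate q (toLex (r, x)) = toLex (q * r, x) := rfl

theorem translate_one : translate (1 : Q) = Equiv.refl (Edge Q X) := by
  ext ⟨r, x⟩
  exact congrArg (fun s => toLex (s, x)) (one_mul r)

theorem translate_mul (q r : Q) :
    (translate (q * r) : Edge Q X ≃ Edge Q X) = (translate r).trans (translate q) := by
  ext ⟨s, x⟩
  exact congrArg (fun s => toLex (s, x)) (mul_assoc q r s)

/-- The action of `Q` on the one-chains of its Cayley graph. -/
noncomputable def action (Q X : Type*) [Group Q] : Q →* MulAut (Multiplicative (Edge Q X →₀ ℤ)) where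
  toFun q := AddEquiv.toMultiplicative (Finsupp.domCongr (translate q))
  map_one' := by
    ext c : 1
    change Multiplicative.ofAdd (Finsupp.equivMapDomain (translate 1) c.toAdd) = c
    rw [translate_one, Finsupp.equivMapDomain_refl]
    rfl
  map_mul' q r := by
    ext c : 1
    change Multiplicative.ofAdd (Finsupp.equivMapDomain (translate (q * r)) c.toAdd) =
      Multiplicative.ofAdd (Finsupp.equivMapDomain (translate q)
        (Finsupp.equivMapDomain (translate r) c.toAdd))
    rw [translate_mul, Finsupp.equivMapDomain_trans]

theorem toAdd_action (q : Q) (c : Multiplicative (Edge Q X →₀ ℤ)) :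
    (action Q X q c).toAdd = Finsupp.equivMapDomain (translate q) c.toAdd := rfl

/-- The target of the Magnus embedding. -/
abbrev Wreath (Q X : Type*) [Group Q] : Type _ :=
  Multiplicative (Edge Q X →₀ ℤ) ⋊[action Q X] Q

/-- The Magnus homomorphism attached to a homomorphism from a free group. -/
noncomputable def hom (π : FreeGroup X →* Q) : FreeGroup X →* Wreath Q X :=
  FreeGroup.lift fun x =>
    ⟨Multiplicative.ofAdd (Finsupp.single (toLex (1, x)) 1), π (FreeGroup.of x)⟩

theorem hom_of (π : FreeGroup X →* Q) (x : X) : hom π (FreeGroup.of x) =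
    ⟨Multiplicative.ofAdd (Finsupp.single (toLex (1, x)) 1), π (FreeGroup.of x)⟩ := by
  simp [hom]

@[simp]
theorem right_hom (π : FreeGroup X →* Q) (w : FreeGroup X) : (hom π w).right = π w := by
  have : SemidirectProduct.rightHom.comp (hom π) = π := by
    ext x
    simp [hom]
  exact DFunLike.congr_fun this w

section Transversal

variable (π : FreeGroup X →* Q) (s : Q → FreeGroup X) (hs : ∀ q, π (s q) = q)

/-- The loop `s q * w * (s (q * π w))⁻¹` as an element of the kernel of `π`. -/
def loop (q : Q) (w : FreeGroup X) : π.ker :=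
  ⟨s q * w * (s (q * π w))⁻¹, by simp [MonoidHom.mem_ker, hs]⟩

theorem loop_mul (q : Q) (v w : FreeGroup X) :
    loop π s hs q (v * w) = loop π s hs q v * loop π s hs (q * π v) w := by
  ext
  simp [loop, mul_assoc]

/-- The homomorphism sending an edge to the class of its loop. -/
noncomputable def loopHom : Multiplicative (Edge Q X →₀ ℤ) →* Abelianization π.ker :=
  AddMonoidHom.toMultiplicativeLeft (Finsupp.liftAddHom fun e =>
    zmultiplesHom _ (Additive.ofMul
      (Abelianization.of (loop π s hs (ofLex e).1 (FreeGroup.of (ofLex e).2)))))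

/-- The left component of `hom π w` is the chain of the path read by `w` in the Cayley graph, here
started at `q`. Both sides obey the same cocycle rule in `w` and agree on generators. -/
theorem loopHom_action_hom (w : FreeGroup X) (q : Q) :
    loopHom π s hs (action Q X q (hom π w).left) = Abelianization.of (loop π s hs q w) := by
  have mul (v w : FreeGroup X) (q : Q) :
      loopHom π s hs (action Q X q (hom π (v * w)).left) =
        loopHom π s hs (action Q X q (hom π v).left) *
          loopHom π s hs (action Q X (q * π v) (hom π w).left) := by
    simp
  have one (q : Q) :
      loopHom π s hs (action Q X q (hom π 1).left) = Abelianization.of (loop π s hs q 1) := by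
    have : loop π s hs q 1 = 1 := by ext; simp [loop]
    simp [this]
  induction w using FreeGroup.induction_on generalizing q with
  | C1 => exact one q
  | of x =>
    have : action Q X q (hom π (FreeGroup.of x)).left =
        Multiplicative.ofAdd (Finsupp.single (toLex (q, x)) 1) := by
      apply Multiplicative.toAdd.injective
      rw [toAdd_action, hom_of]
      simp
    rw [this]
    simp [loopHom]
  | inv_of x ih =>
    have h1 := mul (FreeGroup.of x)⁻¹ (FreeGroup.of x) q
    rw [inv_mul_cancel, one, ← inv_mul_cancel (FreeGroup.of x), loop_mul, map_mul, ih] at h1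
    exact (mul_right_cancel h1).symm
  | mul v w hv hw => rw [mul, hv, hw, loop_mul, map_mul]

end Transversal

theorem ker_hom_le (π : FreeGroup X →* Q) (hπ : Function.Surjective π) :
    (hom π).ker ≤ ⁅π.ker, π.ker⁆ := by
  intro w hw
  have hs (q : Q) : π (Function.surjInv hπ q) = q := Function.surjInv_eq hπ q
  have hw1 : hom π w = 1 := hw
  have hπw : π w = 1 := by rw [← right_hom, hw1]; rfl
  have h := loopHom_action_hom π _ hs w 1
  rw [hw1] at h
  simp only [SemidirectProduct.one_left, map_one] at h
  have h2 : loop π _ hs 1 w ∈ commutator π.ker := by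
    rw [← Abelianization.ker_of]
    exact h.symm
  -- The chosen lift of `1` need not be `1`, so the loop at `1` is only a conjugate of `w`.
  have h3 : (Function.surjInv hπ 1) * w * (Function.surjInv hπ 1)⁻¹ ∈ ⁅π.ker, π.ker⁆ := by
    rw [← Subgroup.map_subtype_commutator]
    exact ⟨_, h2, by simp [loop, hπw]⟩
  simpa [mul_assoc] using
    (inferInstance : (⁅π.ker, π.ker⁆ : Subgroup _).Normal).conj_mem _ h3 (Function.surjInv hπ 1)⁻¹

end Translation

theorem derivedSeries_two_wreath [CommGroup Q] : derivedSeries (Wreath Q X) 2 = ⊥ := by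
  refine derivedSeries_two_eq_bot SemidirectProduct.rightHom fun g hg h hh => ?_
  have hg : g.right = 1 := hg
  have hh : h.right = 1 := hh
  ext1 <;> simp [hg, hh, mul_comm]

section Order

variable [CommGroup Q] [LinearOrder Q] [IsOrderedMonoid Q] [LinearOrder X]

theorem translate_strictMono (q : Q) : StrictMono (translate q : Edge Q X → Edge Q X) := by
  intro a b h
  refine Prod.Lex.lt_iff.2 ?_
  replace h := Prod.Lex.lt_iff.1 h
  rcases h with h | ⟨h, h'⟩
  · exact Or.inl (mul_lt_mul_right h q)
  · exact Or.inr ⟨congrArg (q * ·) h, h'⟩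

/-- Translation preserves the order of edges, so it carries the first nonzero coefficient to the
first nonzero coefficient. -/
theorem toLex_equivMapDomain_pos (q : Q) {c : Edge Q X →₀ ℤ} (hc : 0 < toLex c) :
    0 < toLex (Finsupp.equivMapDomain (translate q) c) := by
  obtain ⟨i, hi, hi'⟩ := Finsupp.Lex.lt_iff.1 hc
  refine Finsupp.Lex.lt_iff.2 ⟨translate q i, fun j hj => ?_, ?_⟩
  · have : (translate q).symm j < i := by
      rwa [← (translate_strictMono q).lt_iff_lt, Equiv.apply_symm_apply]
    exact hi _ this
  · change 0 < c ((translate q).symm (translate q i))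
    rw [Equiv.symm_apply_apply]
    exact hi'

theorem isConeOn_ker : IsConeOn (SemidirectProduct.rightHom : Wreath Q X →* Q).ker
    {g | 0 < toLex g.left.toAdd} where
  one_notMem := lt_irrefl (0 : Lex (Edge Q X →₀ ℤ))
  mul_mem g hg h _ hg' hh' := by
    have hg : g.right = 1 := hg
    have : (g * h).left = g.left * h.left := by simp [hg]
    rw [Set.mem_ofPred_eq, this]
    exact add_pos (α := Lex (Edge Q X →₀ ℤ)) hg' hh'
  conj_mem g hg hg' f := by
    have hg : g.right = 1 := hg
    have : (f * g * f⁻¹).left = action Q X f.right g.left := by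
      simp [hg, mul_comm]
    rw [Set.mem_ofPred_eq, this]
    exact toLex_equivMapDomain_pos f.right hg'
  total g hg := by
    have hg : g.right = 1 := hg
    have : (g⁻¹).left = g.left⁻¹ := by simp [hg]
    rw [Set.mem_ofPred_eq, Set.mem_ofPred_eq, this]
    rcases lt_trichotomy (0 : Lex (Edge Q X →₀ ℤ)) (toLex g.left.toAdd) with h | h | h
    · exact Or.inr (Or.inl h)
    · exact Or.inl (SemidirectProduct.ext h.symm hg)
    · exact Or.inr (Or.inr (neg_pos (α := Lex (Edge Q X →₀ ℤ)).2 h))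

theorem exists_isConeOn_wreath : ∃ P : Set (Wreath Q X), IsConeOn ⊤ P :=
  ⟨_, (IsConeOn.of_linearOrder Q).lex _ isConeOn_ker⟩

end Order

end Magnus

/-! ### Bi-orders on the free metabelian group -/

namespace FreeMetabelianGroup

theorem exists_abelianization_hom (X : Type*) :
    ∃ π : FreeGroup X →* Multiplicative (Lex (X →₀ ℤ)),
      Function.Surjective π ∧ π.ker = commutator (FreeGroup X) := by
  let e : Abelianization (FreeGroup X) ≃* Multiplicative (Lex (X →₀ ℤ)) :=
    AddEquiv.toMultiplicativeRight (FreeAbelianGroup.equivFinsupp X)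
  refine ⟨e.toMonoidHom.comp Abelianization.of,
    e.surjective.comp (QuotientGroup.mk_surjective), ?_⟩
  rw [← Abelianization.ker_of]
  ext w
  simp

theorem exists_isConeOn (n : ℕ) : ∃ P : Set (FreeMetabelianGroup n), IsConeOn ⊤ P := by
  obtain ⟨π, hπ, hker⟩ := exists_abelianization_hom (Fin n)
  obtain ⟨P, hP⟩ :=
    Magnus.exists_isConeOn_wreath (Q := Multiplicative (Lex (Fin n →₀ ℤ))) (X := Fin n)
  refine ⟨_, hP.comap (QuotientGroup.lift _ (Magnus.hom π)
    (derivedSeries_two_le_ker Magnus.derivedSeries_two_wreath _)) ?_⟩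
  rw [← MonoidHom.ker_eq_bot_iff, eq_bot_iff]
  intro g hg
  induction g using QuotientGroup.induction_on with
  | H w =>
    -- As `π.ker` is the derived subgroup, its commutator subgroup is the second derived one: the
    -- Magnus map is injective on the quotient.
    have : w ∈ ⁅π.ker, π.ker⁆ := Magnus.ker_hom_le π hπ hg
    rw [hker, ← derivedSeries_one] at this
    exact (QuotientGroup.eq_one_iff w).2 this

theorem exists_isBiOrder_inv_le_le {n : ℕ} (hn : 2 < n) {t : Fin n → ℤ} (ht : t ≠ 0) :
    ∃ o : LinearOrder (FreeMetabelianGroup n), IsBiOrder o ∧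
      ∃ c ∈ commutator (FreeMetabelianGroup n), o.le c⁻¹ (monomial t) ∧ o.le (monomial t) c := by
  obtain ⟨f, hf, c, hc, hfc⟩ := exists_hom_ratHeisenberg hn ht
  obtain ⟨P, hP⟩ := exists_isConeOn n
  obtain ⟨o, ho, hle⟩ := (RatHeisenberg.isConeOn.lex f (hP.mono le_top)).exists_isBiOrder
  refine ⟨o, ho, ?_⟩
  rcases RatHeisenberg.isConeOn.total (f c) trivial with h | h | h
  · exact absurd h hfc
  · exact ⟨c, hc, hle _ _ (Or.inl (by simpa [hf] using h)),
      hle _ _ (Or.inl (by simpa [hf] using h))⟩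
  · exact ⟨c⁻¹, inv_mem hc, hle _ _ (Or.inl (by simpa [hf] using h)),
      hle _ _ (Or.inl (by simpa [hf] using h))⟩

end FreeMetabelianGroup

theorem mainTheorem7 (n : ℕ) (hn : 2 < n) :
    (∀ t : Fin n → ℤ, FreeMetabelianGroup.monomial t ≠ 1 →
      ∃ o : LinearOrder (FreeMetabelianGroup n), IsBiOrder o ∧
        FreeMetabelianGroup.monomial t ∈
          orderConvexHull o (commutator (FreeMetabelianGroup n))) ∧
    (∃ o : LinearOrder (FreeMetabelianGroup n), IsBiOrder o ∧
      ¬ IsOrderConvex o (commutator (FreeMetabelianGroup n) : Set (FreeMetabelianGroup n))) := by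
  constructor
  · intro t ht
    have ht0 : t ≠ 0 := fun h => ht (h ▸ FreeMetabelianGroup.monomial_zero)
    obtain ⟨o, ho, c, hc, h1, h2⟩ := FreeMetabelianGroup.exists_isBiOrder_inv_le_le hn ht0
    refine ⟨o, ho, Subgroup.mem_sInf.2 fun K hK => ?_⟩
    exact hK.2.out' (hK.1 (inv_mem hc)) (hK.1 hc) ⟨h1, h2⟩
  · have ht : (fun _ => 1 : Fin n → ℤ) ≠ 0 := fun h => one_ne_zero (congrFun h ⟨0, by omega⟩)
    obtain ⟨o, ho, c, hc, h1, h2⟩ := FreeMetabelianGroup.exists_isBiOrder_inv_le_le hn ht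
    exact ⟨o, ho, fun h => FreeMetabelianGroup.monomial_notMem_commutator ht
      (h.out' (inv_mem hc) hc ⟨h1, h2⟩)⟩
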